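/- All Hilbert spaces are complex. Let $A=(a_{ij})$ be an $n\times n$ matrix with entries in $\{0,1\}$. An $n$-tuple $\underline T=(T_1,\dots,T_n)$ of bounded operators on a Hilbert space $\mathcal H$ is called a contractive tuple satisfying $A$-relations if $\sum_i T_iT_i^*\le I$ and $T_iT_j=a_{ij}T_iT_j$ for all $i,j$. A minimal Cuntz–Krieger dilation of such a $\underline T$ is a contractive tuple $\tilde{\underline T}=(\tilde T_1,\dots,\tilde T_n)$ satisfying $A$-relations on a Hilbert space $\tilde{\mathcal H}$ that contains $\mathcal H$ as a closed subspace, such that the $\tilde T_i$ are partial isometries with mutually orthogonal ranges, $\tilde T_i^*\tilde T_i=I-\sum_j(1-a_{ij})\tilde T_j\tilde T_j^*$ and $\tilde T_i^*h=T_i^*h$ for all $i$ and all $h\in\mathcal H$, and the vectors $\tilde T_{\alpha_1}\cdots\tilde T_{\alpha_m}h$ ($m\ge 0$, $1\le\alpha_k\le n$, $h\in\mathcal H$) span a dense subspace of $\tilde{\mathcal H}$. Let $C^*(\underline T)\subseteq B(\mathcal H)$ and $C^*(\tilde{\underline T})\subseteq B(\tilde{\mathcal H})$ be the unital $C^*$-algebras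 generated by the tuples. Compression to $\mathcal H$ restricts to a linear map $\theta\colon C^*(\tilde{\underline T})\to C^*(\underline T)$, $\theta(Y)=P_{\mathcal H}Y|_{\mathcal H}$. **Theorem 27.** Let $\underline T$ be a contractive $n$-tuple on $\mathcal H$ satisfying $A$-relations, and let $\tilde{\underline T}$ on $\tilde{\mathcal H}\supseteq\mathcal H$ be its minimal Cuntz–Krieger dilation. 1. Let $\pi_i\colon C^*(\underline T)\to B(\mathcal K_i)$, $i=1,2$, be $*$-homomorphisms, and let $\tilde\pi_i$ be the minimal Stinespring dilation of $\pi_i\circ\theta$; that is, $\tilde\pi_i\colon C^*(\tilde{\underline T})\to B(\tilde{\mathcal K}_i)$ is a unital $*$-homomorphism, $\mathcal K_i$ is a closed subspace of $\tilde{\mathcal K}_i$, $\pi_i(\theta(Y))=P_{\mathcal K_i}\tilde\pi_i(Y)|_{\mathcal K_i}$ for all $Y\in C^*(\tilde{\underline T})$, and the vectors $\tilde\pi_i(Y)k$ ($Y\in C^*(\tilde{\underline T})$, $k\in\mathcal K_i$) span a dense subspace of $\tilde{\mathcal K}_i$. If $X\colon\mathcal K_1\to\mathcal K_2$ is a bounded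 operator with $X\pi_1(Y)=\pi_2(Y)X$ for all $Y\in C^*(\underline T)$, then there exists a bounded operator $\tilde X\colon\tilde{\mathcal K}_1\to\tilde{\mathcal K}_2$ such that $\tilde X\tilde\pi_1(Y)=\tilde\pi_2(Y)\tilde X$ for all $Y\in C^*(\tilde{\underline T})$, $\tilde XP_{\mathcal K_1}=P_{\mathcal K_2}\tilde X$, and $\tilde X|_{\mathcal K_1}=X$. 2. For every $X\in C^*(\underline T)'$ there exists a unique $\tilde X\in C^*(\tilde{\underline T})'\cap\{P_{\mathcal H}\}'$ such that $P_{\mathcal H}\tilde X|_{\mathcal H}=X$. Moreover $X\mapsto\tilde X$ is a $*$-isomorphism from $C^*(\underline T)'$ onto $C^*(\tilde{\underline T})'\cap\{P_{\mathcal H}\}'$. -/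

import Mathlib

namespace CuntzKrieger

open ContinuousLinearMap

variable {n : ℕ} {H L : Type*}
  [NormedAddCommGroup H] [InnerProductSpace ℂ H] [CompleteSpace H]
  [NormedAddCommGroup L] [InnerProductSpace ℂ L] [CompleteSpace L]

/-- The operator `T_{α₁} T_{α₂} ⋯ T_{αₘ}` of a word `α`; the empty word gives the identity. -/
def word (T : Fin n → H →L[ℂ] H) (α : List (Fin n)) : H →L[ℂ] H :=
  (α.map T).prod

/-- `C*(T)`: the unital `C*`-algebra generated by the tuple `T`, i.e. the norm closure of the
unital `*`-subalgebra of `B(H)` generated by the `T i`. -/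
noncomputable def CStar (T : Fin n → H →L[ℂ] H) : StarSubalgebra ℂ (H →L[ℂ] H) :=
  (StarAlgebra.adjoin ℂ (Set.range T)).topologicalClosure

/-- A contractive tuple (`∑ T i (T i)* ≤ 1`) satisfying the `A`-relations
`T i T j = a i j T i T j`. -/
structure IsARelationTuple (A : Matrix (Fin n) (Fin n) ℂ) (T : Fin n → H →L[ℂ] H) : Prop where
  contractive : ∑ i, T i * star (T i) ≤ 1
  relation : ∀ i j, T i * T j = A i j • (T i * T j)

/-- `R` on `L` is a dilation of `T` on `H`, where `H` is identified with a closed subspace of `L`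
through the isometry `V`: each `(R i)*` extends `(T i)*`. -/
def IsDilation (T : Fin n → H →L[ℂ] H) (R : Fin n → L →L[ℂ] L) (V : H →ₗᵢ[ℂ] L) : Prop :=
  ∀ i h, star (R i) (V h) = V (star (T i) h)

/-- `R` is a minimal Cuntz–Krieger dilation of `T`. -/
structure IsMinimalCKDilation (A : Matrix (Fin n) (Fin n) ℂ)
    (T : Fin n → H →L[ℂ] H) (R : Fin n → L →L[ℂ] L) (V : H →ₗᵢ[ℂ] L) : Prop where
  dilation : IsDilation T R V
  partialIsometry : ∀ i, R i * star (R i) * R i = R i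
  orthogonalRanges : ∀ i j, i ≠ j → ∀ x y, inner ℂ (R i x) (R j y) = 0
  aRelation : IsARelationTuple A R
  ckRelation : ∀ i, star (R i) * R i = 1 - ∑ j, (1 - A i j) • (R j * star (R j))
  minimal : (Submodule.span ℂ {x | ∃ α h, x = word R α (V h)}).topologicalClosure = ⊤

/-- The compression `P_H Y|_H` of an operator `Y` on `L` to the space `H`, embedded in `L` by the
isometry `V`. -/
noncomputable def compress (V : H →ₗᵢ[ℂ] L) : (L →L[ℂ] L) →ₗ[ℂ] (H →L[ℂ] H) where
  toFun Y := adjoint V.toContinuousLinearMap ∘L Y ∘L V.toContinuousLinearMap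
  map_add' Y Z := by ext; simp
  map_smul' c Y := by ext; simp

/-- The orthogonal projection `P_H` of `L` onto the embedded space `H`; for an isometry `V` it is
`V V*`. -/
noncomputable def proj (V : H →ₗᵢ[ℂ] L) : L →L[ℂ] L :=
  V.toContinuousLinearMap ∘L adjoint V.toContinuousLinearMap

/-- `ρ : 𝒜 → B(L)` is a minimal Stinespring dilation of the map `φ : 𝒜 → B(H)`, where `H` is
identified with a closed subspace of `L` through the isometry `V`: `φ Y = P_H ρ(Y)|_H`, and the
vectors `ρ(Y) h` with `h` in `H` span a dense subspace of `L`. -/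
structure IsMinimalStinespring {𝒜 : Type*} [Ring 𝒜] [StarRing 𝒜] [Algebra ℂ 𝒜]
    (φ : 𝒜 → H →L[ℂ] H) (ρ : 𝒜 →⋆ₐ[ℂ] (L →L[ℂ] L)) (V : H →ₗᵢ[ℂ] L) : Prop where
  compress_eq : ∀ Y, compress V (ρ Y) = φ Y
  minimal : (Submodule.span ℂ {x | ∃ Y h, x = ρ Y (V h)}).topologicalClosure = ⊤

section

variable {A : Matrix (Fin n) (Fin n) ℂ} {T : Fin n → H →L[ℂ] H} {R : Fin n → L →L[ℂ] L}
  {V : H →ₗᵢ[ℂ] L}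

lemma mem_CStar (T : Fin n → H →L[ℂ] H) (i : Fin n) : T i ∈ CStar T :=
  StarSubalgebra.le_topologicalClosure _ (StarAlgebra.subset_adjoin ℂ _ ⟨i, rfl⟩)

lemma word_mem_CStar (T : Fin n → H →L[ℂ] H) (α : List (Fin n)) : word T α ∈ CStar T := by
  induction α with
  | nil => exact one_mem (CStar T)
  | cons i α ih => simpa [word] using mul_mem (mem_CStar T i) ih

lemma star_word_apply (hd : IsDilation T R V) (α : List (Fin n)) (h : H) :
    star (word R α) (V h) = V (star (word T α) h) := by
  induction α generalizing h with
  | nil => simp [word]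
  | cons i α ih =>
    have := ih (star (T i) h)
    rw [← hd i h] at this
    simpa [word] using this

lemma compress_word (hd : IsDilation T R V) (α β : List (Fin n)) :
    compress V (word R α * star (word R β)) = word T α * star (word T β) := by
  ext h
  refine ext_inner_left ℂ fun k => ?_
  have h1 := star_word_apply hd α k
  have h2 := star_word_apply hd β h
  calc inner ℂ k (compress V (word R α * star (word R β)) h)
      = inner ℂ (V k) (word R α (star (word R β) (V h))) := by
        simp [compress, adjoint_inner_right]
    _ = inner ℂ (star (word R α) (V k)) (star (word R β) (V h)) := by
        rw [star_eq_adjoint (word R α), adjoint_inner_left]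
    _ = inner ℂ (star (word T α) k) (star (word T β) h) := by
        rw [h1, h2, V.inner_map_map]
    _ = inner ℂ k ((word T α * star (word T β)) h) := by
        rw [star_eq_adjoint (word T α), adjoint_inner_left]; rfl

/-- The span of the operators `R^α (R^β)*`. -/
def wordSpan (R : Fin n → L →L[ℂ] L) : Submodule ℂ (L →L[ℂ] L) :=
  Submodule.span ℂ {Y | ∃ α β, Y = word R α * star (word R β)}

lemma gen_mul_mem (i : Fin n) {Y : L →L[ℂ] L} (hY : Y ∈ wordSpan R) : R i * Y ∈ wordSpan R := by
  induction hY using Submodule.span_induction with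
  | mem Y hY =>
    obtain ⟨α, β, rfl⟩ := hY
    exact Submodule.subset_span ⟨i :: α, β, by simp [word, mul_assoc]⟩
  | zero => simp
  | add Y Z _ _ h1 h2 => rw [mul_add]; exact add_mem h1 h2
  | smul c Y _ h1 => rw [mul_smul_comm]; exact Submodule.smul_mem _ c h1

lemma IsMinimalCKDilation.star_mul_of_ne (hR : IsMinimalCKDilation A T R V) {i j : Fin n}
    (hij : i ≠ j) : star (R i) * R j = 0 := by
  ext y
  refine ext_inner_left ℂ fun x => ?_
  simpa [star_eq_adjoint, adjoint_inner_right] using hR.orthogonalRanges i j hij x y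

lemma star_gen_mul_mem (hR : IsMinimalCKDilation A T R V) (i : Fin n) {Y : L →L[ℂ] L}
    (hY : Y ∈ wordSpan R) : star (R i) * Y ∈ wordSpan R := by
  induction hY using Submodule.span_induction with
  | mem Y hY =>
    obtain ⟨α, β, rfl⟩ := hY
    cases α with
    | nil => exact Submodule.subset_span ⟨[], β ++ [i], by simp [word]⟩
    | cons j α =>
      by_cases hij : i = j
      · subst hij
        have key : star (R i) * (word R (i :: α) * star (word R β))
            = (star (R i) * R i) * (word R α * star (word R β)) := by
          simp [word, mul_assoc]
        rw [key, hR.ckRelation, sub_mul, one_mul, Finset.sum_mul]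
        refine sub_mem (Submodule.subset_span ⟨α, β, rfl⟩) (sum_mem fun k _ => ?_)
        rw [smul_mul_assoc]
        refine Submodule.smul_mem _ _ ?_
        cases α with
        | nil => exact Submodule.subset_span ⟨[k], β ++ [k], by simp [word, mul_assoc]⟩
        | cons l α =>
          by_cases hkl : k = l
          · subst hkl
            refine Submodule.subset_span ⟨k :: α, β, ?_⟩
            have := hR.partialIsometry k
            simp only [word, List.map_cons, List.prod_cons, ← mul_assoc]
            rw [this]
          · have : R k * star (R k) * (word R (l :: α) * star (word R β)) = 0 := by
              have h0 := hR.star_mul_of_ne hkl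
              have : R k * star (R k) * (word R (l :: α) * star (word R β))
                  = R k * (star (R k) * R l) * ((α.map R).prod * star (word R β)) := by
                simp [word, mul_assoc]
              rw [this, h0]; simp
            rw [this]; exact zero_mem _
      · have : star (R i) * (word R (j :: α) * star (word R β)) = 0 := by
          have h0 := hR.star_mul_of_ne hij
          have : star (R i) * (word R (j :: α) * star (word R β))
              = (star (R i) * R j) * ((α.map R).prod * star (word R β)) := by
            simp [word, mul_assoc]
          rw [this, h0]; simp
        rw [this]; exact zero_mem _
  | zero => simp
  | add Y Z _ _ h1 h2 => rw [mul_add]; exact add_mem h1 h2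
  | smul c Y _ h1 => rw [mul_smul_comm]; exact Submodule.smul_mem _ c h1

lemma adjoin_le_wordSpan (hR : IsMinimalCKDilation A T R V) {Y : L →L[ℂ] L}
    (hY : Y ∈ StarAlgebra.adjoin ℂ (Set.range R)) : Y ∈ wordSpan R := by
  have key : ∀ Z ∈ wordSpan R, Y * Z ∈ wordSpan R := by
    change Y ∈ (StarAlgebra.adjoin ℂ (Set.range R)).toSubalgebra at hY
    rw [StarAlgebra.adjoin_toSubalgebra] at hY
    induction hY using Algebra.adjoin_induction with
    | mem Y hY =>
      intro Z hZ
      rcases hY with ⟨i, rfl⟩ | ⟨i, hi⟩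
      · exact gen_mul_mem i hZ
      · rw [← star_star Y, ← hi]; exact star_gen_mul_mem hR i hZ
    | algebraMap c =>
      intro Z hZ
      rw [← Algebra.smul_def]; exact Submodule.smul_mem _ c hZ
    | add Y₁ Y₂ _ _ h1 h2 => intro Z hZ; rw [add_mul]; exact add_mem (h1 Z hZ) (h2 Z hZ)
    | mul Y₁ Y₂ _ _ h1 h2 => intro Z hZ; rw [mul_assoc]; exact h1 _ (h2 Z hZ)
  simpa using key 1 (Submodule.subset_span ⟨[], [], by simp [word]⟩)

/-- The compression to `H` maps `C*(R)` into `C*(T)` when `R` is a Cuntz–Krieger dilation. -/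
lemma compress_mem (hR : IsMinimalCKDilation A T R V) {Y : L →L[ℂ] L} (hY : Y ∈ CStar R) :
    compress V Y ∈ CStar T := by
  have hcont : Continuous (compress V) :=
    continuous_const.clm_comp (continuous_id.clm_comp continuous_const)
  have hclosed : IsClosed {Y : L →L[ℂ] L | compress V Y ∈ CStar T} :=
    (StarSubalgebra.isClosed_topologicalClosure _).preimage hcont
  refine closure_minimal (fun Z hZ => ?_) hclosed hY
  have hZ' := adjoin_le_wordSpan hR hZ
  change compress V Z ∈ CStar T
  clear hZ
  induction hZ' using Submodule.span_induction with
  | mem Z hZ =>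
    obtain ⟨α, β, rfl⟩ := hZ
    rw [compress_word hR.dilation]
    exact mul_mem (word_mem_CStar T α) (star_mem (word_mem_CStar T β))
  | zero => rw [map_zero]; exact zero_mem _
  | add Y Z _ _ h1 h2 => rw [map_add]; exact add_mem h1 h2
  | smul c Y _ h1 => rw [map_smul]; exact SMulMemClass.smul_mem c h1

/-- The map `θ : C*(R) → C*(T)`, `Y ↦ P_H Y|_H`: the restriction of the compression to `B(H)`. -/
noncomputable def theta (hR : IsMinimalCKDilation A T R V) : CStar R →ₗ[ℂ] CStar T where
  toFun Y := ⟨compress V (Y : L →L[ℂ] L), compress_mem hR Y.2⟩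
  map_add' Y Z := Subtype.ext (map_add (compress V) (Y : L →L[ℂ] L) Z)
  map_smul' c Y := Subtype.ext (map_smul (compress V) c (Y : L →L[ℂ] L))

end

end CuntzKrieger

/-! The lift is forced on a total set: it must send `ρ₁ Y (W₁ k)` to `ρ₂ Y (W₂ (X k))`, and the only
issue is boundedness. Put `Q = (‖X‖² - X*X)^{1/2}`. Since `X*X` commutes with every `φ₁ Y`, so does
`Q`, and the Gram matrices of the three families `ρ₁ Y W₁ k`, `ρ₂ Y W₂ X k`, `ρ₁ Y W₁ Q k` satisfy
an exact identity, giving `‖f x‖² + ‖g x‖² = ‖X‖² ‖e x‖²` on formal sums. Dropping `g` bounds the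
lift by `‖X‖` (`exists_intertwiner_stinespring`).

For commutants, the inclusion of `C*(R)` in `B(L)` is itself a minimal Stinespring dilation of `θ`,
so lifts exist (`exists_lift`). Compression is multiplicative on `{P_H}'` and injective on `C*(R)' ∩
{P_H}'` by minimality, hence its inverse there is the required `*`-isomorphism. -/

namespace CuntzKrieger

open ContinuousLinearMap

/-! ### Lifting intertwiners to minimal Stinespring dilations -/

section Intertwiner

variable {𝒜 E : Type*} [Ring 𝒜] [StarRing 𝒜] [Algebra ℂ 𝒜]
  {K₁ K₂ M₁ M₂ : Type*}
  [NormedAddCommGroup K₁] [InnerProductSpace ℂ K₁] [CompleteSpace K₁]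
  [NormedAddCommGroup K₂] [InnerProductSpace ℂ K₂] [CompleteSpace K₂]
  [NormedAddCommGroup M₁] [InnerProductSpace ℂ M₁] [CompleteSpace M₁]
  [NormedAddCommGroup M₂] [InnerProductSpace ℂ M₂] [CompleteSpace M₂]

/-- The defect operator of `X`: a square root of `‖X‖² - X* X` which commutes with all operators
that commute with `X* X`. -/
lemma exists_defect (X : K₁ →L[ℂ] K₂) :
    ∃ Q : K₁ →L[ℂ] K₁, (∀ S, Commute (adjoint X ∘L X) S → Commute Q S) ∧
      ∀ k l, inner ℂ (X k) (X l) + inner ℂ (Q k) (Q l) = ((‖X‖ ^ 2 : ℝ) : ℂ) * inner ℂ k l := by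
  set D : K₁ →L[ℂ] K₁ := algebraMap ℝ _ (‖X‖ ^ 2) - adjoint X ∘L X with hD
  have hsa : IsSelfAdjoint (adjoint X ∘L X) := by
    rw [isSelfAdjoint_iff', adjoint_comp, adjoint_adjoint]
  have hnonneg : 0 ≤ D := by
    have h := hsa.le_algebraMap_norm_self
    rw [norm_adjoint_comp_self, ← sq] at h
    exact sub_nonneg.2 h
  -- The root is a continuous function of the self-adjoint `D`, so it inherits the commutation
  -- relations of `D`.
  have hcomm : ∀ S, Commute (adjoint X ∘L X) S → Commute (CFC.sqrt D) S := by
    intro S hS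
    rw [CFC.sqrt_eq_cfc]
    exact (Commute.sub_left (Algebra.commutes (‖X‖ ^ 2) S) hS).cfc_nnreal _
  refine ⟨CFC.sqrt D, hcomm, fun k l => ?_⟩
  have hQ : star (CFC.sqrt D) = CFC.sqrt D :=
    (IsSelfAdjoint.of_nonneg (CFC.sqrt_nonneg D)).star_eq
  have h1 : inner ℂ (CFC.sqrt D k) (CFC.sqrt D l) = inner ℂ k (D l) := by
    rw [← adjoint_inner_right, ← star_eq_adjoint, hQ, ← comp_apply, ← mul_def, CFC.sqrt_mul_sqrt_self D hnonneg]
  rw [h1, ← adjoint_inner_right, ← inner_add_right, hD]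
  simp [Algebra.algebraMap_eq_smul_one, inner_smul_right, ← Complex.coe_smul]

/-- Gram matrices of the vectors `ρ Y (W k)` depend on `φ` alone. -/
lemma inner_stinespring {φ : 𝒜 → K₁ →L[ℂ] K₁} {ρ : 𝒜 →⋆ₐ[ℂ] (M₁ →L[ℂ] M₁)} {W : K₁ →ₗᵢ[ℂ] M₁}
    (hφ : ∀ Y, compress W (ρ Y) = φ Y) (Y Z : 𝒜) (k l : K₁) :
    inner ℂ (ρ Y (W k)) (ρ Z (W l)) = inner ℂ k (φ (star Y * Z) l) := by
  rw [← hφ, map_mul, map_star]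
  simp [compress, adjoint_inner_right, star_eq_adjoint]

/-- No symmetry of `φ` is assumed; it is inherited from `ρ`. -/
lemma star_stinespring {φ : 𝒜 → K₁ →L[ℂ] K₁} {ρ : 𝒜 →⋆ₐ[ℂ] (M₁ →L[ℂ] M₁)} {W : K₁ →ₗᵢ[ℂ] M₁}
    (hφ : ∀ Y, compress W (ρ Y) = φ Y) (Y : 𝒜) : φ (star Y) = adjoint (φ Y) := by
  rw [← hφ, ← hφ, map_star]
  simp [compress, star_eq_adjoint, adjoint_comp, comp_assoc]

/-- The formal sums `∑ Y ⊗ k` mapped to `∑ ρ(Y) W k`. -/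
noncomputable def formalSum (ρ : 𝒜 →⋆ₐ[ℂ] (M₁ →L[ℂ] M₁)) (W : E → M₁) :
    ((𝒜 × E) →₀ ℂ) →ₗ[ℂ] M₁ :=
  Finsupp.linearCombination ℂ fun p => ρ p.1 (W p.2)

lemma formalSum_single (ρ : 𝒜 →⋆ₐ[ℂ] (M₁ →L[ℂ] M₁)) (W : E → M₁) (p : 𝒜 × E) (c : ℂ) :
    formalSum ρ W (Finsupp.single p c) = c • ρ p.1 (W p.2) := by
  simp [formalSum]

lemma IsMinimalStinespring.denseRange_formalSum {φ : 𝒜 → K₁ →L[ℂ] K₁}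
    {ρ : 𝒜 →⋆ₐ[ℂ] (M₁ →L[ℂ] M₁)} {W : K₁ →ₗᵢ[ℂ] M₁} (h : IsMinimalStinespring φ ρ W) :
    DenseRange (formalSum ρ W) := by
  have hr : LinearMap.range (formalSum ρ W) = Submodule.span ℂ {x | ∃ Y h, x = ρ Y (W h)} := by
    rw [formalSum, Finsupp.range_linearCombination]
    congr 1
    ext x
    simp [eq_comm]
  have hd := (Submodule.dense_iff_topologicalClosure_eq_top).2 h.minimal
  rw [← hr] at hd
  exact hd

/-- An intertwiner of two completely positive maps extends to the minimal Stinespring dilation. -/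
theorem exists_intertwiner_stinespring {φ₁ : 𝒜 → K₁ →L[ℂ] K₁} {φ₂ : 𝒜 → K₂ →L[ℂ] K₂}
    {ρ₁ : 𝒜 →⋆ₐ[ℂ] (M₁ →L[ℂ] M₁)} {ρ₂ : 𝒜 →⋆ₐ[ℂ] (M₂ →L[ℂ] M₂)}
    {W₁ : K₁ →ₗᵢ[ℂ] M₁} {W₂ : K₂ →ₗᵢ[ℂ] M₂}
    (h₁ : IsMinimalStinespring φ₁ ρ₁ W₁) (h₂ : ∀ Y, compress W₂ (ρ₂ Y) = φ₂ Y)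
    (X : K₁ →L[ℂ] K₂) (hX : ∀ Y, X ∘L φ₁ Y = φ₂ Y ∘L X) :
    ∃ X' : M₁ →L[ℂ] M₂,
      (∀ Y, X' ∘L ρ₁ Y = ρ₂ Y ∘L X') ∧
      X' ∘L proj W₁ = proj W₂ ∘L X' ∧
      X' ∘L W₁.toContinuousLinearMap = W₂.toContinuousLinearMap ∘L X := by
  obtain ⟨Q, hQ, hdef⟩ := exists_defect X
  -- Adjoints reverse the intertwining, so `X*X` commutes with each `φ₁ Y`.
  have hXs : ∀ Y, adjoint X ∘L φ₂ Y = φ₁ Y ∘L adjoint X := fun Y => by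
    have h := congrArg adjoint (hX (star Y))
    simpa [adjoint_comp, star_stinespring h₁.compress_eq, star_stinespring h₂] using h.symm
  have hQφ : ∀ Y k, Q (φ₁ Y k) = φ₁ Y (Q k) := fun Y k => by
    refine DFunLike.congr_fun (hQ (φ₁ Y) ?_).eq k
    change (adjoint X ∘L X) ∘L φ₁ Y = φ₁ Y ∘L (adjoint X ∘L X)
    rw [comp_assoc, hX, ← comp_assoc, hXs, comp_assoc]
  have hXφ : ∀ Y k, φ₂ Y (X k) = X (φ₁ Y k) := fun Y k => (DFunLike.congr_fun (hX Y) k).symm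
  set e := formalSum ρ₁ W₁ with he
  set f := formalSum ρ₂ (fun k => W₂ (X k)) with hf
  set g := formalSum ρ₁ (fun k => W₁ (Q k)) with hg
  have key : ∀ x y, inner ℂ (f x) (f y) + inner ℂ (g x) (g y)
      = ((‖X‖ ^ 2 : ℝ) : ℂ) * inner ℂ (e x) (e y) := by
    intro x y
    induction x using Finsupp.induction_linear with
    | zero => simp
    | add x x' hx hx' =>
      simp only [map_add, inner_add_left, mul_add, ← hx, ← hx']; ring
    | single p c =>
      induction y using Finsupp.induction_linear with
      | zero => simp
      | add y y' hy hy' =>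
        simp only [map_add, inner_add_right, mul_add, ← hy, ← hy']; ring
      | single q d =>
        simp only [he, hf, hg, formalSum_single, inner_smul_left, inner_smul_right,
          inner_stinespring h₁.compress_eq, inner_stinespring h₂, ← hQφ, hXφ]
        -- Moving `φ₁ (Y* Z)` inside `X` and `Q` leaves the defect identity at a single pair of
        -- vectors.
        linear_combination (starRingEnd ℂ c) * d * hdef p.2 (φ₁ (star p.1 * q.1) q.2)
  -- This also gives well-definedness: `e x = 0` forces `f x = 0`.
  have hbound : ∀ x, ‖f x‖ ≤ ‖X‖ * ‖e x‖ := fun x => by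
    have h := key x x
    simp only [inner_self_eq_norm_sq_to_K] at h
    have h' : ‖f x‖ ^ 2 + ‖g x‖ ^ 2 = ‖X‖ ^ 2 * ‖e x‖ ^ 2 := by
      apply Complex.ofReal_injective
      push_cast
      simpa using h
    refine le_of_sq_le_sq ?_ (by positivity)
    nlinarith [sq_nonneg ‖g x‖]
  have hdense : DenseRange e := h₁.denseRange_formalSum
  have hX' : ∀ Y k, f.extendOfNorm e (ρ₁ Y (W₁ k)) = ρ₂ Y (W₂ (X k)) := fun Y k => by
    have h := LinearMap.extendOfNorm_eq hdense ⟨_, hbound⟩ (Finsupp.single (Y, k) 1)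
    simpa [he, hf, formalSum_single] using h
  have hX'W : ∀ k, f.extendOfNorm e (W₁ k) = W₂ (X k) := fun k => by simpa using hX' 1 k
  have hext : ∀ {N : Type _} [NormedAddCommGroup N] [NormedSpace ℂ N] (S S' : M₁ →L[ℂ] N),
      (∀ Y k, S (ρ₁ Y (W₁ k)) = S' (ρ₁ Y (W₁ k))) → S = S' := by
    intro N _ _ S S' h
    refine ContinuousLinearMap.ext_on
      ((Submodule.dense_iff_topologicalClosure_eq_top).2 h₁.minimal) ?_
    rintro _ ⟨Y, k, rfl⟩
    exact h Y k
  refine ⟨f.extendOfNorm e, fun Y => hext _ _ fun Z k => ?_, hext _ _ fun Z k => ?_, ?_⟩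
  · have h := hX' (Y * Z) k
    simp only [map_mul] at h
    simpa [hX'] using h
  -- Both sides send `ρ₁ Z (W₁ k)` to `W₂ (X (φ₁ Z k))`.
  · have a₁ : adjoint W₁.toContinuousLinearMap (ρ₁ Z (W₁ k)) = φ₁ Z k := by
      rw [← h₁.compress_eq]; rfl
    have a₂ : adjoint W₂.toContinuousLinearMap (ρ₂ Z (W₂ (X k))) = φ₂ Z (X k) := by
      rw [← h₂]; rfl
    simp [proj, hX', a₁, a₂, hX'W, hXφ]
  · ext k
    exact hX'W k

end Intertwiner

/-! ### Compression on commutants -/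

section Commutant

variable {n : ℕ} {H L : Type*}
  [NormedAddCommGroup H] [InnerProductSpace ℂ H] [CompleteSpace H]
  [NormedAddCommGroup L] [InnerProductSpace ℂ L] [CompleteSpace L]
  {A : Matrix (Fin n) (Fin n) ℂ} {T : Fin n → H →L[ℂ] H} {R : Fin n → L →L[ℂ] L}
  {V : H →ₗᵢ[ℂ] L}

lemma compress_apply (Y : L →L[ℂ] L) (h : H) :
    compress V Y h = adjoint V.toContinuousLinearMap (Y (V h)) := rfl

lemma adjoint_isometry_apply (h : H) : adjoint V.toContinuousLinearMap (V h) = h :=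
  ext_inner_left ℂ fun k => by simp [adjoint_inner_right]

lemma compress_one : compress V 1 = 1 := by
  ext h; simp [compress_apply, adjoint_isometry_apply]

lemma compress_star (Y : L →L[ℂ] L) : compress V (star Y) = star (compress V Y) := by
  simp [compress, star_eq_adjoint, adjoint_comp, comp_assoc]

/-- Commuting with `P_H` makes `H` invariant, so compressing is restricting. -/
lemma apply_compress {Y : L →L[ℂ] L} (hY : proj V * Y = Y * proj V) (h : H) :
    V (compress V Y h) = Y (V h) := by
  have := DFunLike.congr_fun hY (V h)
  simpa [proj, adjoint_isometry_apply, compress_apply] using this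

/-- It is enough that the right factor leaves `H` invariant. -/
lemma compress_mul {Y Z : L →L[ℂ] L} (hZ : proj V * Z = Z * proj V) :
    compress V (Y * Z) = compress V Y * compress V Z := by
  ext h
  rw [mul_def (compress V Y), comp_apply, compress_apply, compress_apply, apply_compress hZ,
    mul_def, comp_apply]

/-- `C*(T)` lies in the double commutant of its generators, so only these need testing. -/
lemma mem_centralizer_CStar {S : H →L[ℂ] H}
    (h : ∀ i, T i * S = S * T i ∧ star (T i) * S = S * star (T i)) :
    S ∈ StarSubalgebra.centralizer ℂ (CStar T : Set (H →L[ℂ] H)) := by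
  have hS : S ∈ StarSubalgebra.centralizer ℂ (Set.range T) :=
    StarSubalgebra.mem_centralizer_iff ℂ |>.2 (Set.forall_mem_range.2 h)
  refine StarSubalgebra.mem_centralizer_iff ℂ |>.2 fun g hg => ?_
  have key : ∀ g ∈ CStar T, g * S = S * g := fun g hg =>
    (((StarSubalgebra.mem_centralizer_iff ℂ).1
      (StarSubalgebra.topologicalClosure_adjoin_le_centralizer_centralizer ℂ _ hg) S hS).1).symm
  exact ⟨key g hg, key _ (star_mem hg)⟩

lemma compress_mem_centralizer (hd : IsDilation T R V) {Y : L →L[ℂ] L}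
    (hY : Y ∈ StarSubalgebra.centralizer ℂ (CStar R : Set (L →L[ℂ] L)))
    (hP : Y ∈ StarSubalgebra.centralizer ℂ {proj V}) :
    compress V Y ∈ StarSubalgebra.centralizer ℂ (CStar T : Set (H →L[ℂ] H)) := by
  have key : ∀ Z ∈ StarSubalgebra.centralizer ℂ (CStar R : Set (L →L[ℂ] L)),
      Z ∈ StarSubalgebra.centralizer ℂ {proj V} → ∀ i,
      star (T i) * compress V Z = compress V Z * star (T i) := by
    intro Z hZ hP i
    have hP' := ((StarSubalgebra.mem_centralizer_iff ℂ).1 hP _ rfl).1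
    have hZ' := ((StarSubalgebra.mem_centralizer_iff ℂ).1 hZ _ (mem_CStar R i)).2
    ext h
    apply V.injective
    rw [mul_def, mul_def, comp_apply, comp_apply, ← hd, apply_compress hP', apply_compress hP', ← hd]
    exact DFunLike.congr_fun hZ' (V h)
  refine mem_centralizer_CStar fun i => ⟨?_, key Y hY hP i⟩
  -- The dilation relation concerns only the adjoints `(R i)*`; the relation for `T i` comes from
  -- applying `key` to `Y*`.
  have h := congrArg star (key (star Y) (star_mem hY) (star_mem hP) i)
  simpa [compress_star] using h.symm

/-- The inclusion of `C*(R)` in `B(L)` is a minimal Stinespring dilation of `θ`. -/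
lemma IsMinimalCKDilation.isMinimalStinespring (hR : IsMinimalCKDilation A T R V) :
    IsMinimalStinespring (fun Y : CStar R => (theta hR Y : H →L[ℂ] H)) (CStar R).subtype V where
  compress_eq _ := rfl
  minimal := by
    refine top_unique (hR.minimal.ge.trans (Submodule.topologicalClosure_mono
      (Submodule.span_mono ?_)))
    rintro _ ⟨α, h, rfl⟩
    exact ⟨⟨_, word_mem_CStar R α⟩, h, rfl⟩

/-- The compression is injective on `C*(R)' ∩ {P_H}'`. -/
lemma eq_of_compress_eq (hR : IsMinimalCKDilation A T R V) {Y Z : L →L[ℂ] L}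
    (hY : Y ∈ StarSubalgebra.centralizer ℂ (CStar R : Set (L →L[ℂ] L)) ⊓
      StarSubalgebra.centralizer ℂ {proj V})
    (hZ : Z ∈ StarSubalgebra.centralizer ℂ (CStar R : Set (L →L[ℂ] L)) ⊓
      StarSubalgebra.centralizer ℂ {proj V})
    (h : compress V Y = compress V Z) : Y = Z := by
  refine ContinuousLinearMap.ext_on
    ((Submodule.dense_iff_topologicalClosure_eq_top).2 hR.minimal) ?_
  rintro _ ⟨α, k, rfl⟩
  -- Moving `S` past the word shows that its compression determines it on a total set.
  have comm : ∀ S ∈ StarSubalgebra.centralizer ℂ (CStar R : Set (L →L[ℂ] L)) ⊓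
      StarSubalgebra.centralizer ℂ {proj V},
      S (word R α (V k)) = word R α (V (compress V S k)) := fun S hS => by
    rw [apply_compress ((StarSubalgebra.mem_centralizer_iff ℂ).1 hS.2 _ rfl).1]
    exact (DFunLike.congr_fun
      ((StarSubalgebra.mem_centralizer_iff ℂ).1 hS.1 _ (word_mem_CStar R α)).1 (V k)).symm
  rw [comm Y hY, comm Z hZ, h]

/-- The intertwiner theorem with both dilations equal to the inclusion of `C*(R)`. -/
lemma exists_lift (hR : IsMinimalCKDilation A T R V) {X : H →L[ℂ] H}
    (hX : X ∈ StarSubalgebra.centralizer ℂ (CStar T : Set (H →L[ℂ] H))) :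
    ∃ X' ∈ StarSubalgebra.centralizer ℂ (CStar R : Set (L →L[ℂ] L)) ⊓
      StarSubalgebra.centralizer ℂ {proj V}, compress V X' = X := by
  have hS := hR.isMinimalStinespring
  obtain ⟨X', h1, h2, h3⟩ := exists_intertwiner_stinespring hS hS.compress_eq X fun Y =>
      (((StarSubalgebra.mem_centralizer_iff ℂ).1 hX _ (theta hR Y).2).1).symm
  have hP : star (proj V) = proj V := by simp [proj, star_eq_adjoint, adjoint_comp]
  refine ⟨X', ⟨?_, ?_⟩, ?_⟩
  · exact (StarSubalgebra.mem_centralizer_iff ℂ).2 fun g hg =>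
      ⟨(h1 ⟨g, hg⟩).symm, (h1 ⟨star g, star_mem hg⟩).symm⟩
  · refine (StarSubalgebra.mem_centralizer_iff ℂ).2 fun g hg => ?_
    rw [Set.mem_singleton_iff.1 hg, hP]
    exact ⟨h2.symm, h2.symm⟩
  · ext h
    have := DFunLike.congr_fun h3 h
    simp only [comp_apply, LinearIsometry.coe_toContinuousLinearMap] at this
    rw [compress_apply, this, adjoint_isometry_apply]

/-- The compression, as a `*`-homomorphism from `C*(R)' ∩ {P_H}'` to `C*(T)'`. -/
noncomputable def compressCommutant (hd : IsDilation T R V) :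
    ↥(StarSubalgebra.centralizer ℂ (CStar R : Set (L →L[ℂ] L)) ⊓
      StarSubalgebra.centralizer ℂ {proj V}) →⋆ₐ[ℂ]
    StarSubalgebra.centralizer ℂ (CStar T : Set (H →L[ℂ] H)) where
  toFun Y := ⟨compress V Y, compress_mem_centralizer hd Y.2.1 Y.2.2⟩
  map_one' := Subtype.ext compress_one
  map_mul' Y Z := Subtype.ext
    (compress_mul ((StarSubalgebra.mem_centralizer_iff ℂ).1 Z.2.2 _ rfl).1)
  map_zero' := Subtype.ext (map_zero (compress V))
  map_add' Y Z := Subtype.ext (map_add (compress V) (Y : L →L[ℂ] L) Z)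
  commutes' c := Subtype.ext <| by
    simp [Algebra.algebraMap_eq_smul_one, compress_one]
  map_star' Y := Subtype.ext (compress_star _)

lemma compressCommutant_bijective (hR : IsMinimalCKDilation A T R V) :
    Function.Bijective (compressCommutant hR.dilation) := by
  refine ⟨fun Y Z h => Subtype.ext
    (eq_of_compress_eq hR Y.2 Z.2 (congrArg Subtype.val h)), fun X => ?_⟩
  obtain ⟨X', hX', h⟩ := exists_lift hR X.2
  exact ⟨⟨X', hX'⟩, Subtype.ext h⟩

end Commutant

end CuntzKrieger

open CuntzKrieger in
theorem theorem27 {n : ℕ} {A : Matrix (Fin n) (Fin n) ℂ}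
    (hA : ∀ i j, A i j = 0 ∨ A i j = 1)
    {H L : Type*} [NormedAddCommGroup H] [InnerProductSpace ℂ H] [CompleteSpace H]
    [NormedAddCommGroup L] [InnerProductSpace ℂ L] [CompleteSpace L]
    (T : Fin n → H →L[ℂ] H) (hT : IsARelationTuple A T)
    (R : Fin n → L →L[ℂ] L) (V : H →ₗᵢ[ℂ] L) (hR : IsMinimalCKDilation A T R V) :
    (∀ {K₁ K₂ M₁ M₂ : Type*}
        [NormedAddCommGroup K₁] [InnerProductSpace ℂ K₁] [CompleteSpace K₁]
        [NormedAddCommGroup K₂] [InnerProductSpace ℂ K₂] [CompleteSpace K₂]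
        [NormedAddCommGroup M₁] [InnerProductSpace ℂ M₁] [CompleteSpace M₁]
        [NormedAddCommGroup M₂] [InnerProductSpace ℂ M₂] [CompleteSpace M₂]
        (π₁ : CStar T →⋆ₙₐ[ℂ] (K₁ →L[ℂ] K₁)) (π₂ : CStar T →⋆ₙₐ[ℂ] (K₂ →L[ℂ] K₂))
        (ρ₁ : CStar R →⋆ₐ[ℂ] (M₁ →L[ℂ] M₁)) (ρ₂ : CStar R →⋆ₐ[ℂ] (M₂ →L[ℂ] M₂))
        (W₁ : K₁ →ₗᵢ[ℂ] M₁) (W₂ : K₂ →ₗᵢ[ℂ] M₂) (X : K₁ →L[ℂ] K₂),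
        (∀ Y : CStar T, X ∘L π₁ Y = π₂ Y ∘L X) →
        IsMinimalStinespring (fun Y => π₁ (theta hR Y)) ρ₁ W₁ →
        IsMinimalStinespring (fun Y => π₂ (theta hR Y)) ρ₂ W₂ →
        ∃ X' : M₁ →L[ℂ] M₂,
          (∀ Y : CStar R, X' ∘L ρ₁ Y = ρ₂ Y ∘L X') ∧
          X' ∘L proj W₁ = proj W₂ ∘L X' ∧
          X' ∘L W₁.toContinuousLinearMap = W₂.toContinuousLinearMap ∘L X) ∧
    (∀ X ∈ StarSubalgebra.centralizer ℂ (CStar T : Set (H →L[ℂ] H)),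
        ∃! X' : L →L[ℂ] L,
          X' ∈ StarSubalgebra.centralizer ℂ (CStar R : Set (L →L[ℂ] L)) ⊓
            StarSubalgebra.centralizer ℂ {proj V} ∧
          compress V X' = X) ∧
    (∃ Φ : StarSubalgebra.centralizer ℂ (CStar T : Set (H →L[ℂ] H)) ≃⋆ₐ[ℂ]
          ↥(StarSubalgebra.centralizer ℂ (CStar R : Set (L →L[ℂ] L)) ⊓
            StarSubalgebra.centralizer ℂ {proj V}),
        ∀ X, compress V (Φ X : L →L[ℂ] L) = (X : H →L[ℂ] H)) := by
  refine ⟨?_, fun X hX => ?_, ?_⟩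
  · intro K₁ K₂ M₁ M₂ _ _ _ _ _ _ _ _ _ _ _ _ π₁ π₂ ρ₁ ρ₂ W₁ W₂ X hX h₁ h₂
    exact exists_intertwiner_stinespring h₁ h₂.compress_eq X fun Y => hX (theta hR Y)
  · obtain ⟨X', hX', h⟩ := exists_lift hR hX
    exact ⟨X', ⟨hX', h⟩, fun Z hZ => eq_of_compress_eq hR hZ.1 hX' (hZ.2.trans h.symm)⟩
  -- Inverting the compression makes the algebraic properties of the lift automatic.
  · let Ψ := StarAlgEquiv.ofBijective (compressCommutant hR.dilation)
      (compressCommutant_bijective hR)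
    exact ⟨Ψ.symm, fun X => congrArg Subtype.val (Ψ.apply_symm_apply X)⟩
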